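/- Let $X$ be a Tychonoff (completely regular Hausdorff) space and let $\mathcal B$ be a bornology on $X$, i.e. a family of subsets of $X$ that contains all singletons and is closed under subsets and finite unions. Let $\mathcal C_{\mathcal B}(X)$ be the set of continuous maps $f:X\to\mathbb R$ such that $f(B)$ is bounded for every $B\in\mathcal B$. For a continuous $f:X\to\mathbb R$ let $f^\beta:\beta(X)\to\mathbb R\cup\{\infty\}$ be its unique continuous extension from the Stone–Čech compactification of $X$ to the one-point compactification of $\mathbb R$, and put $$\upsilon_{\mathcal B}(X)=\{p\in\beta(X)\mid f^\beta(p)\neq\infty\text{ for all }f\in\mathcal C_{\mathcal B}(X)\},$$ with the subspace topology of $\beta(X)$; it contains $X$. For a set $\mathcal C$ of real-valued maps on a set $Y$ let $(Y,\mathcal C)$ denote $Y$ with the coarsest uniformity that makes all members of $\mathcal C$ uniformly continuous, and for a topological space $Y$ let $\mathcal C(Y)$ be the set of all continuous maps $Y\to\mathbb R$. Then: 1. $(\upsilon_{\mathcal B}(X),\mathcal C(\upsilon_{\mathcal B}(X)))$ is the completion of $(X,\mathcal C_{\mathcal B}(X))$: its uniformity induces the topology of $\upsilon_{\mathcal B}(X)$,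 it is a complete Hausdorff uniform space, and the inclusion $X\hookrightarrow\upsilon_{\mathcal B}(X)$ is a uniform embedding of $(X,\mathcal C_{\mathcal B}(X))$ with dense image. 2. Consequently, $(X,\mathcal B)$ is realcompact, i.e. $\upsilon_{\mathcal B}(X)=X$, if and only if the uniform space $(X,\mathcal C_{\mathcal B}(X))$ is complete. -/

import Mathlib

open Set Topology

/-- The uniformity on `X` that is initial for a set `C` of real valued maps on `X`, where `ℝ`
carries its usual uniformity: the coarsest one making every `f ∈ C` uniformly continuous. -/
@[reducible]
def initialUniformity {X : Type*} (C : Set (X → ℝ)) : UniformSpace X :=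
  ⨅ f ∈ C, UniformSpace.comap f inferInstance

/-- `C(X)`: the continuous real valued maps on `X`. -/
def continuousMaps (X : Type*) [TopologicalSpace X] : Set (X → ℝ) :=
  {f | Continuous f}

/-- `C_B(X)`: the continuous real valued maps on `X` that are bounded on every bounded set of the
bornological universe `X`. -/
def boundedContinuousMaps (X : Type*) [TopologicalSpace X] [Bornology X] : Set (X → ℝ) :=
  {f | Continuous f ∧ ∀ B : Set X, Bornology.IsBounded B → Bornology.IsBounded (f '' B)}

/-- `f^β`: the unique continuous extension of a continuous map `f : X → ℝ` to a map from the
Stone–Čech compactification `β(X)` to the one-point compactification of `ℝ`. -/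
noncomputable def betaExtension {X : Type*} [TopologicalSpace X] (f : X → ℝ) (hf : Continuous f) :
    StoneCech X → OnePoint ℝ :=
  stoneCechExtend (g := fun x => ((f x : ℝ) : OnePoint ℝ)) (OnePoint.continuous_coe.comp hf)

theorem betaExtension_unit {X : Type*} [TopologicalSpace X] (f : X → ℝ) (hf : Continuous f)
    (x : X) : betaExtension f hf (stoneCechUnit x) = ((f x : ℝ) : OnePoint ℝ) :=
  stoneCechExtend_stoneCechUnit _ x

/-- `υ_B(X)`: the points of `β(X)` at which `f^β` is finite for every `f ∈ C_B(X)`. As a type it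
carries the subspace topology of `β(X)`. -/
def upsilon (X : Type*) [TopologicalSpace X] [Bornology X] : Set (StoneCech X) :=
  {p | ∀ f : X → ℝ, ∀ hf : f ∈ boundedContinuousMaps X,
    betaExtension f hf.1 p ≠ OnePoint.infty}

/-- The canonical map `X → υ_B(X)`, the corestriction of `X → β(X)`. -/
def toUpsilon (X : Type*) [TopologicalSpace X] [Bornology X] (x : X) : upsilon X :=
  ⟨stoneCechUnit x, fun f hf => by
    rw [betaExtension_unit f hf.1 x]
    exact OnePoint.coe_ne_infty _⟩

/-- The bornological universe `X` is realcompact: `υ_B(X)` equals (the image in `β(X)` of) `X`. -/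
def IsRealcompactUniverse (X : Type*) [TopologicalSpace X] [Bornology X] : Prop :=
  upsilon X = Set.range (stoneCechUnit : X → StoneCech X)

/-- The uniform space `(Y, uY)` is, via the map `i : X → Y`, the (Hausdorff) completion of the
uniform space `(X, uX)`: it is complete and Hausdorff, and `i` is a uniform embedding with dense
image. -/
structure IsCompletionVia {X Y : Type*} (uX : UniformSpace X) (uY : UniformSpace Y)
    (i : X → Y) : Prop where
  complete : CompleteSpace Y
  hausdorff : T2Space Y
  isUniformEmbedding : IsUniformEmbedding i
  denseRange : DenseRange i

/-!
The completion of `(X, C_B(X))` is computed inside the compact Hausdorff space `β(X)`.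

Restriction along `X → υ_B(X)` maps `C(υ_B(X))` onto `C_B(X)`
(`image_comp_toUpsilon_continuousMaps`). A function `f ∈ C_B(X)` extends, because by the definition
of `υ_B(X)` the extension `f^β` is real valued there. Conversely, the closure in `β(X)` of a bounded
set `B` is contained in `υ_B(X)`, since `f^β` maps it into the closure of the bounded set `f(B)`;
this closure is compact, so every continuous real valued map on `υ_B(X)` is bounded on `B`. As
initial uniformities are compatible with pulling back, `X → υ_B(X)` is uniformly inducing.

The space `υ_B(X)` is completely regular, so the uniformity of `C(υ_B(X))` induces its topology. For
completeness, let `U` be an ultrafilter on `υ_B(X)` along which all continuous real valued maps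
converge. It converges to some `p` in the compact space `β(X)`. For `f ∈ C_B(X)`, the value `f^β(p)`
is the limit of `f^β` along `U`, hence finite; so `p ∈ υ_B(X)`.

The criterion for realcompactness follows: `X` is complete if and only if its image in the
Hausdorff space `υ_B(X)` is complete, and a dense subset of a complete Hausdorff space is complete
only if it is the whole space.
-/

open Filter

/-! ### Initial uniformities -/

theorem uniformContinuous_of_mem_initialUniformity {Y : Type*} {C : Set (Y → ℝ)} {f : Y → ℝ}
    (hf : f ∈ C) : @UniformContinuous Y ℝ (initialUniformity C) _ f :=
  uniformContinuous_iff_le_comap.2 (iInf₂_le f hf)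

theorem toTopologicalSpace_initialUniformity {Y : Type*} (C : Set (Y → ℝ)) :
    (initialUniformity C).toTopologicalSpace =
      ⨅ f ∈ C, TopologicalSpace.induced f inferInstance := by
  simp only [UniformSpace.toTopologicalSpace_iInf]
  rfl

theorem comap_initialUniformity {Y Z : Type*} (i : Y → Z) (C : Set (Z → ℝ)) :
    (initialUniformity C).comap i = initialUniformity ((fun g => g ∘ i) '' C) := by
  simp only [initialUniformity, UniformSpace.comap_iInf, iInf_image, ← UniformSpace.comap_comap]

theorem toTopologicalSpace_initialUniformity_continuousMaps (Y : Type*) [t : TopologicalSpace Y]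
    [CompletelyRegularSpace Y] :
    (initialUniformity (continuousMaps Y)).toTopologicalSpace = t := by
  rw [toTopologicalSpace_initialUniformity]
  refine le_antisymm ?_ (le_iInf₂ fun f hf => continuous_iff_le_induced.1 hf)
  -- A `[0, 1]`-valued map that vanishes at `x` and equals `1` off `K` shows that `K` is a
  -- neighbourhood of `x` in the initial topology.
  intro K hK
  refine (@isOpen_iff_mem_nhds Y (_) K).2 fun x hx => ?_
  obtain ⟨f, hf, hfx, hfK⟩ := CompletelyRegularSpace.completely_regular_isOpen x K hK hx
  have hg : (fun y => (f y : ℝ)) ∈ continuousMaps Y := continuous_subtype_val.comp hf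
  have hc : @Continuous Y ℝ (⨅ f ∈ continuousMaps Y, TopologicalSpace.induced f inferInstance) _
      (fun y => (f y : ℝ)) := continuous_iff_le_induced.2 (iInf₂_le _ hg)
  have hmem : (fun y => (f y : ℝ)) ⁻¹' Iio 1 ∈
      @nhds Y (⨅ f ∈ continuousMaps Y, TopologicalSpace.induced f inferInstance) x := by
    refine @IsOpen.mem_nhds Y (_) x _ (@IsOpen.preimage Y ℝ (_) _ _ hc _ isOpen_Iio) ?_
    simp [hfx]
  refine mem_of_superset hmem fun y hy => ?_
  by_contra hyK
  have := hfK hyK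
  simp [this] at hy

/-- A Cauchy ultrafilter for an initial uniformity is one along which all maps of the family
converge, so completeness amounts to the convergence of these ultrafilters. -/
theorem completeSpace_initialUniformity {Y : Type*} [t : TopologicalSpace Y] {C : Set (Y → ℝ)}
    (ht : (initialUniformity C).toTopologicalSpace = t)
    (h : ∀ U : Ultrafilter Y, (∀ f ∈ C, ∃ r, Tendsto f U (𝓝 r)) → ∃ y, (U : Filter Y) ≤ 𝓝 y) :
    @CompleteSpace Y (initialUniformity C) := by
  subst ht
  let := initialUniformity C
  refine completeSpace_iff_ultrafilter.2 fun U hU => h U fun f hf => ?_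
  exact cauchy_map_iff_exists_tendsto.1 (hU.map (uniformContinuous_of_mem_initialUniformity hf))

/-! ### The subspace `υ_B(X)` of `β(X)` -/

theorem continuous_betaExtension {X : Type*} [TopologicalSpace X] (f : X → ℝ)
    (hf : Continuous f) : Continuous (betaExtension f hf) :=
  continuous_stoneCechExtend _

section Upsilon

variable {X : Type*} [TopologicalSpace X] [Bornology X]

theorem continuous_toUpsilon : Continuous (toUpsilon X) :=
  continuous_stoneCechUnit.subtype_mk _

theorem denseRange_toUpsilon : DenseRange (toUpsilon X) := by
  refine Subtype.dense_iff.2 fun p _ => ?_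
  rw [← range_comp]
  exact denseRange_stoneCechUnit p

/-- On `υ_B(X)` the extension `f^β` of `f ∈ C_B(X)` is real valued and continuous. -/
theorem exists_continuous_coe_eq_betaExtension {f : X → ℝ} (hf : f ∈ boundedContinuousMaps X) :
    ∃ g : upsilon X → ℝ, Continuous g ∧
      ∀ p : upsilon X, (g p : OnePoint ℝ) = betaExtension f hf.1 p := by
  choose g hg using fun p : upsilon X => OnePoint.ne_infty_iff_exists.1 (p.2 f hf)
  refine ⟨g, OnePoint.isOpenEmbedding_coe.isInducing.continuous_iff.2 ?_, hg⟩
  exact ((continuous_betaExtension f hf.1).comp continuous_subtype_val).congr fun p => (hg p).symm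

theorem closure_image_stoneCechUnit_subset_upsilon {B : Set X} (hB : Bornology.IsBounded B) :
    closure (stoneCechUnit '' B) ⊆ upsilon X := by
  intro p hp f hf hinf
  -- The closure of `f(B)` is compact in `ℝ`, hence still closed in the one-point compactification.
  have hK : IsCompact ((↑) '' closure (f '' B) : Set (OnePoint ℝ)) :=
    (hf.2 B hB).isCompact_closure.image OnePoint.continuous_coe
  have hsub : closure (stoneCechUnit '' B) ⊆
      betaExtension f hf.1 ⁻¹' ((↑) '' closure (f '' B)) := by
    refine closure_minimal ?_ (hK.isClosed.preimage (continuous_betaExtension f hf.1))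
    rintro _ ⟨x, hx, rfl⟩
    exact ⟨f x, subset_closure (mem_image_of_mem f hx), (betaExtension_unit f hf.1 x).symm⟩
  obtain ⟨r, -, hr⟩ := hsub hp
  exact OnePoint.coe_ne_infty r (hr.trans hinf)

theorem comp_toUpsilon_mem_boundedContinuousMaps {g : upsilon X → ℝ} (hg : Continuous g) :
    g ∘ toUpsilon X ∈ boundedContinuousMaps X := by
  refine ⟨hg.comp continuous_toUpsilon, fun B hB => ?_⟩
  have hK : IsCompact ((↑) ⁻¹' closure (stoneCechUnit '' B) : Set (upsilon X)) := by
    rw [IsInducing.subtypeVal.isCompact_preimage_iff]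
    · exact isClosed_closure.isCompact
    · rw [Subtype.range_coe]
      exact closure_image_stoneCechUnit_subset_upsilon hB
  refine (hK.image hg).isBounded.subset ?_
  rintro _ ⟨x, hx, rfl⟩
  exact mem_image_of_mem g (subset_closure (mem_image_of_mem stoneCechUnit hx))

theorem image_comp_toUpsilon_continuousMaps :
    (fun g => g ∘ toUpsilon X) '' continuousMaps (upsilon X) = boundedContinuousMaps X := by
  refine Subset.antisymm ?_ fun f hf => ?_
  · rintro _ ⟨g, hg, rfl⟩
    exact comp_toUpsilon_mem_boundedContinuousMaps hg
  · obtain ⟨g, hg, hgf⟩ := exists_continuous_coe_eq_betaExtension hf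
    refine ⟨g, hg, funext fun x => OnePoint.coe_injective ?_⟩
    exact (hgf (toUpsilon X x)).trans (betaExtension_unit f hf.1 x)

theorem toTopologicalSpace_initialUniformity_upsilon :
    (initialUniformity (continuousMaps (upsilon X))).toTopologicalSpace =
      (instTopologicalSpaceSubtype : TopologicalSpace (upsilon X)) :=
  toTopologicalSpace_initialUniformity_continuousMaps (upsilon X)

theorem completeSpace_upsilon :
    @CompleteSpace (upsilon X) (initialUniformity (continuousMaps (upsilon X))) := by
  refine completeSpace_initialUniformity toTopologicalSpace_initialUniformity_upsilon
    fun U hU => ?_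
  obtain ⟨p, -, hp⟩ := isCompact_univ.ultrafilter_le_nhds (U.map ((↑) : upsilon X → StoneCech X))
    (by simp)
  have hp' : Tendsto ((↑) : upsilon X → StoneCech X) U (𝓝 p) := hp
  have hpu : p ∈ upsilon X := by
    intro f hf
    obtain ⟨g, hg, hgf⟩ := exists_continuous_coe_eq_betaExtension hf
    obtain ⟨r, hr⟩ := hU g hg
    have h₁ : Tendsto (fun q : upsilon X => betaExtension f hf.1 q) U
        (𝓝 (betaExtension f hf.1 p)) :=
      ((continuous_betaExtension f hf.1).tendsto p).comp hp'
    have h₂ : Tendsto (fun q : upsilon X => betaExtension f hf.1 q) U (𝓝 (r : OnePoint ℝ)) :=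
      ((OnePoint.continuous_coe.tendsto r).comp hr).congr hgf
    rw [tendsto_nhds_unique h₁ h₂]
    exact OnePoint.coe_ne_infty r
  exact ⟨⟨p, hpu⟩, tendsto_subtype_rng.2 hp'⟩

theorem isUniformInducing_toUpsilon :
    @IsUniformInducing X (upsilon X) (initialUniformity (boundedContinuousMaps X))
      (initialUniformity (continuousMaps (upsilon X))) (toUpsilon X) := by
  refine (@isUniformInducing_iff_uniformSpace _ _ (_) (_) _).2 ?_
  rw [comap_initialUniformity, image_comp_toUpsilon_continuousMaps]

theorem isRealcompactUniverse_iff_surjective_toUpsilon :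
    IsRealcompactUniverse X ↔ Function.Surjective (toUpsilon X) := by
  constructor
  · rintro h ⟨p, hp⟩
    obtain ⟨x, rfl⟩ := h.subset hp
    exact ⟨x, rfl⟩
  · refine fun h => Subset.antisymm (fun p hp => ?_) ?_
    · obtain ⟨x, hx⟩ := h ⟨p, hp⟩
      exact ⟨x, congrArg Subtype.val hx⟩
    · rintro _ ⟨x, rfl⟩
      exact (toUpsilon X x).2

end Upsilon

/-! ### Completion and realcompactness -/

theorem isCompletionVia_toUpsilon (X : Type*) [TopologicalSpace X] [T35Space X] [Bornology X] :
    IsCompletionVia (initialUniformity (boundedContinuousMaps X))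
      (initialUniformity (continuousMaps (upsilon X))) (toUpsilon X) where
  complete := completeSpace_upsilon
  hausdorff := by
    rw [toTopologicalSpace_initialUniformity_upsilon]
    infer_instance
  isUniformEmbedding := by
    refine @IsUniformEmbedding.mk _ _ (_) (_) _ isUniformInducing_toUpsilon fun x y h => ?_
    exact injective_stoneCechUnit_of_t35Space (congrArg Subtype.val h)
  denseRange := by
    rw [toTopologicalSpace_initialUniformity_upsilon]
    exact denseRange_toUpsilon

/-- The image of `i` is dense; if `X` is complete, it is also complete, hence closed in the
Hausdorff space `Y`. -/
theorem IsCompletionVia.surjective_iff_completeSpace {X Y : Type*} {uX : UniformSpace X}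
    {uY : UniformSpace Y} {i : X → Y} (h : IsCompletionVia uX uY i) :
    Function.Surjective i ↔ CompleteSpace X := by
  have := h.complete
  have := h.hausdorff
  rw [completeSpace_iff_isComplete_range h.isUniformEmbedding.isUniformInducing,
    ← range_eq_univ]
  refine ⟨fun hi => hi ▸ isClosed_univ.isComplete, fun hc => ?_⟩
  rw [← hc.isClosed.closure_eq, h.denseRange.closure_range]

theorem mainTheorem5 (X : Type*) [TopologicalSpace X] [T35Space X] [Bornology X] :
    ((initialUniformity (continuousMaps (upsilon X))).toTopologicalSpace =
        (instTopologicalSpaceSubtype : TopologicalSpace (upsilon X)) ∧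
      IsCompletionVia (initialUniformity (boundedContinuousMaps X))
        (initialUniformity (continuousMaps (upsilon X))) (toUpsilon X)) ∧
    (IsRealcompactUniverse X ↔
      @CompleteSpace X (initialUniformity (boundedContinuousMaps X))) :=
  ⟨⟨toTopologicalSpace_initialUniformity_upsilon, isCompletionVia_toUpsilon X⟩,
    isRealcompactUniverse_iff_surjective_toUpsilon.trans
      (isCompletionVia_toUpsilon X).surjective_iff_completeSpace⟩
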